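/- Let $\mathcal A(\mathbb R)$ be the space of complex-valued real analytic functions on $\mathbb R$ with its natural locally convex inductive limit topology $\mathcal A(\mathbb R)=\operatorname{ind}_{\mathbb R\subset U}H(U)$, where $U$ runs over the open neighbourhoods of $\mathbb R$ in $\mathbb C$ and the space $H(U)$ of holomorphic functions on $U$ carries the compact-open topology. A family $(T_t)_{t\ge 0}$ of continuous linear operators on $\mathcal A(\mathbb R)$ is a $C_0$-semigroup if $T_0=I$, $T_{t+s}=T_tT_s$ for all $t,s\ge 0$, and $\lim_{t\to s}T_tf=T_sf$ for all $s\ge 0$ and $f\in\mathcal A(\mathbb R)$; a linear operator $E$ on $\mathcal A(\mathbb R)$ generates it if for every $f\in\mathcal A(\mathbb R)$ the limit $\lim_{t\searrow 0}\frac{T_tf-f}{t}$ exists in $\mathcal A(\mathbb R)$ and equals $Ef$. Let $a,b\in\mathbb C$. Then the first order Euler differential operator $$Ef(x)=a\,x f'(x)+b\,f(x)$$ is a continuous linear operator on $\mathcal A(\mathbb R)$, and it generates a $C_0$-semigroup on $\mathcal A(\mathbb R)$ if and only if $a\in\mathbb R$. If $a\in\mathbb R$, the semigroup generated by $E$ is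 unique and is given by $$T_tf(x)=e^{bt}f(e^{ta}x)\qquad (t\ge 0,\ f\in\mathcal A(\mathbb R),\ x\in\mathbb R).$$ -/

import Mathlib

open Filter Topology
open scoped NNReal

/-! ### Strongly continuous semigroups on a topological vector space -/

/-- A `C₀`-semigroup of continuous linear operators `(T t)_{t ≥ 0}` on `X`. -/
structure IsC0Semigroup {X : Type*} [AddCommGroup X] [Module ℂ X] [TopologicalSpace X]
    (T : ℝ≥0 → X →L[ℂ] X) : Prop where
  map_add : ∀ t s : ℝ≥0, T (t + s) = (T t).comp (T s)
  map_zero : T 0 = ContinuousLinearMap.id ℂ X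
  tendsto : ∀ (s : ℝ≥0) (x : X), Tendsto (fun t : ℝ≥0 => T t x) (𝓝 s) (𝓝 (T s x))

/-- The graph of the generator of `T`: the pairs `(x, y)` with `y = lim_{t → 0+} (T t x - x) / t`.
The domain of the generator is the set of all `x` for which there is such a `y`. -/
def generatorGraph {X : Type*} [AddCommGroup X] [Module ℂ X] [TopologicalSpace X]
    (T : ℝ≥0 → X →L[ℂ] X) : Set (X × X) :=
  {p | Tendsto (fun t : ℝ≥0 => ((t : ℝ) : ℂ)⁻¹ • (T t p.1 - p.1)) (𝓝[>] 0) (𝓝 p.2)}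

/-- The everywhere defined linear operator `M` generates the `C₀`-semigroup `T`: the generator of
`T` has domain `X` and equals `M`. -/
def Generates {X : Type*} [AddCommGroup X] [Module ℂ X] [TopologicalSpace X]
    (M : X →ₗ[ℂ] X) (T : ℝ≥0 → X →L[ℂ] X) : Prop :=
  IsC0Semigroup T ∧ generatorGraph T = {p | p.2 = M p.1}

/-! ### The spaces `H(U)` -/

/-- The space `H(U)` of holomorphic functions on the open set `U`. As a subspace of `C(U, ℂ)` it
carries the compact-open topology. -/
def HolSpace (U : TopologicalSpace.Opens ℂ) : Submodule ℂ C(U, ℂ) where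
  carrier := {f | ∃ g : ℂ → ℂ, DifferentiableOn ℂ g U ∧ ∀ z : U, f z = g z}
  zero_mem' := ⟨0, differentiableOn_const 0, fun _ => rfl⟩
  add_mem' := by
    rintro f₁ f₂ ⟨g₁, h₁, e₁⟩ ⟨g₂, h₂, e₂⟩
    exact ⟨g₁ + g₂, h₁.add h₂, fun z => by simp [e₁, e₂]⟩
  smul_mem' := by
    rintro c f ⟨g, h, e⟩
    exact ⟨c • g, h.const_smul c, fun z => by simp [e]⟩

/-! ### The space `A(ℝ)` -/

/-- The complex-valued real analytic functions on `ℝ`, as a subspace of all functions `ℝ → ℂ`. -/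
def realAnalyticSubmodule : Submodule ℂ (ℝ → ℂ) where
  carrier := {f | AnalyticOnNhd ℝ f Set.univ}
  zero_mem' := analyticOnNhd_const
  add_mem' := fun hf hg => hf.add hg
  smul_mem' := fun _ _ hf x hx => analyticAt_const.smul (hf x hx)

/-- The space `A(ℝ)` of complex-valued real analytic functions on `ℝ`. This is a separate type, so
that it does not inherit the topology of pointwise convergence. -/
def RealAnalytic : Type := realAnalyticSubmodule

namespace RealAnalytic

noncomputable instance : AddCommGroup RealAnalytic :=
  inferInstanceAs (AddCommGroup realAnalyticSubmodule)

noncomputable instance : Module ℂ RealAnalytic :=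
  inferInstanceAs (Module ℂ realAnalyticSubmodule)

instance : FunLike RealAnalytic ℝ ℂ where
  coe f := f.1
  coe_injective := fun _ _ h => Subtype.ext h

theorem analyticOnNhd (f : RealAnalytic) : AnalyticOnNhd ℝ f Set.univ := f.2

@[simp] theorem add_apply (f g : RealAnalytic) (x : ℝ) : (f + g) x = f x + g x := rfl

@[simp] theorem smul_apply (c : ℂ) (f : RealAnalytic) (x : ℝ) : (c • f) x = c * f x := rfl

/-- The restriction map `H(U) → A(ℝ)` for an open set `U ⊆ ℂ` containing `ℝ`. -/
noncomputable def ofHol (U : TopologicalSpace.Opens ℂ) (hU : ∀ x : ℝ, (x : ℂ) ∈ U) (f : HolSpace U) :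
    RealAnalytic :=
  ⟨fun x => f.1 ⟨(x : ℂ), hU x⟩, by
    obtain ⟨g, hg, e⟩ := f.2
    intro x _
    have h : AnalyticAt ℝ g (x : ℂ) := (hg.analyticOnNhd U.isOpen (x : ℂ) (hU x)).restrictScalars
    have h' : AnalyticAt ℝ (fun y : ℝ => g (y : ℂ)) x :=
      AnalyticAt.comp (g := g) (f := fun y : ℝ => (y : ℂ)) h (Complex.ofRealCLM.analyticAt x)
    simpa only [e] using h'⟩

/-- The inductive topology `A(ℝ) = ind_{ℝ ⊆ U} H(U)` in the category of locally convex spaces: the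
finest locally convex vector space topology on `A(ℝ)` for which all restriction maps
`H(U) → A(ℝ)`, with `U` an open neighbourhood of `ℝ` in `ℂ`, are continuous. -/
instance : TopologicalSpace RealAnalytic :=
  sInf {τ : TopologicalSpace RealAnalytic |
    (∀ (U : TopologicalSpace.Opens ℂ) (hU : ∀ x : ℝ, (x : ℂ) ∈ U),
      Continuous[_, τ] (ofHol U hU)) ∧
    @IsTopologicalAddGroup RealAnalytic τ _ ∧
    @ContinuousSMul ℂ RealAnalytic _ _ τ ∧
    @LocallyConvexSpace ℝ RealAnalytic _ _ _ _ τ}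

instance : IsTopologicalAddGroup RealAnalytic :=
  topologicalAddGroup_sInf fun _ ⟨_, h, _, _⟩ => h

instance : ContinuousSMul ℂ RealAnalytic :=
  continuousSMul_sInf fun _ ⟨_, _, h, _⟩ => h

instance : LocallyConvexSpace ℝ RealAnalytic :=
  .sInf fun _ ⟨_, _, _, h⟩ => h

theorem continuous_ofHol (U : TopologicalSpace.Opens ℂ) (hU : ∀ x : ℝ, (x : ℂ) ∈ U) :
    Continuous (ofHol U hU) :=
  continuous_sInf_rng.2 fun _ h => h.1 U hU

/-- The first order Euler operator `E f (x) = a x f'(x) + b f(x)` on `A(ℝ)`. -/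
noncomputable def euler (a b : ℂ) : RealAnalytic →ₗ[ℂ] RealAnalytic where
  toFun f := ⟨fun x => a * (x : ℂ) * deriv f x + b * f x, by
    intro x hx
    have h1 : AnalyticAt ℝ (fun y : ℝ => (y : ℂ)) x := Complex.ofRealCLM.analyticAt x
    have h2 : AnalyticAt ℝ (deriv f) x := (f.analyticOnNhd x hx).deriv
    exact ((analyticAt_const.mul h1).mul h2).add (analyticAt_const.mul (f.analyticOnNhd x hx))⟩
  map_add' f g := by
    refine DFunLike.ext _ _ fun x => ?_
    change a * (x : ℂ) * deriv (⇑f + ⇑g) x + b * (f x + g x) =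
      (a * (x : ℂ) * deriv f x + b * f x) + (a * (x : ℂ) * deriv g x + b * g x)
    rw [deriv_add (f.analyticOnNhd x trivial).differentiableAt
      (g.analyticOnNhd x trivial).differentiableAt]
    ring
  map_smul' c f := by
    refine DFunLike.ext _ _ fun x => ?_
    change a * (x : ℂ) * deriv (fun y => c * f y) x + b * (c * f x) =
      c * (a * (x : ℂ) * deriv f x + b * f x)
    rw [deriv_const_mul c (f.analyticOnNhd x trivial).differentiableAt]
    ring

@[simp] theorem euler_apply (a b : ℂ) (f : RealAnalytic) (x : ℝ) :
    euler a b f x = a * (x : ℂ) * deriv f x + b * f x := rfl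

end RealAnalytic

/-!
The point `0` is fixed by the flow `x ↦ exp (a t) x` of the Euler field, so the Taylor coefficients
at `0` diagonalise the operator: a generated semigroup multiplies the `n`-th coefficient by
`exp ((a n + b) t)`. Hence `T t f` must be a real analytic function on all of `ℝ` with germ
`exp (b t) f (exp (a t) x)` at `0`.

If `a` is not real, the line `exp (a t) ℝ` is not the real line for a suitable `t`, and `f` may have
a pole on it; the function `f x = 1 / (x - exp (a t))` then contradicts the existence of `T t f` at
`x = 1` (`RealAnalytic.im_eq_zero_of_generates_euler`).

If `a` is real, the weighted dilations form a semigroup generated by the operator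
(`RealAnalytic.generates_euler_dilation`). Every `f` extends holomorphically to a neighbourhood of
`ℝ` (`RealAnalytic.exists_eq_ofHol`), and for `t` in a compact set all dilates of `f` lie in one
space `H(V)`. Both limits in the definition of a generated semigroup therefore reduce to joint
continuity of a function of `(t, z)`.

For uniqueness (`RealAnalytic.eq_of_generates_euler`), an orbit of any generated semigroup is
followed along the characteristics of the transport equation. As the inclusion of `A(ℝ)` in
`C(ℝ, ℂ)` is continuous, the product rule holds along these curves without any equicontinuity of the
semigroup, and a scalar linear equation with one-sided derivatives remains.

Continuity of a linear map on `A(ℝ)` is always checked on the steps `H(U)`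
(`RealAnalytic.continuous_of_comp_ofHol`).
-/

/-! ### Holomorphic extension of real analytic functions -/

/-- The complexification of a real power series converges on the complex ball with the same
radius. -/
theorem exists_differentiableOn_ball_eq_of_analyticAt {f : ℝ → ℂ} {x : ℝ} (hf : AnalyticAt ℝ f x) :
    ∃ r > 0, ∃ g : ℂ → ℂ, DifferentiableOn ℂ g (Metric.ball (x : ℂ) r) ∧
      ∀ y : ℝ, (y : ℂ) ∈ Metric.ball (x : ℂ) r → g y = f y := by
  obtain ⟨p, R, hp⟩ := hf
  let q : FormalMultilinearSeries ℂ ℂ ℂ := fun n =>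
    ContinuousMultilinearMap.mkPiRing ℂ (Fin n) (p.coeff n)
  have hn : ∀ n, ‖q n‖ = ‖p n‖ := fun n => by
    simp [q, ContinuousMultilinearMap.norm_mkPiRing]
  have hq : q.radius = p.radius := by simp only [FormalMultilinearSeries.radius, hn]
  have hR : R ≤ q.radius := hq ▸ hp.r_le
  have hq0 : 0 < q.radius := hp.r_pos.trans_le hR
  obtain ⟨r, hr0, hrR⟩ := ENNReal.lt_iff_exists_nnreal_btwn.1 hp.r_pos
  have hqs := q.hasFPowerSeriesOnBall hq0
  refine ⟨r, by exact_mod_cast hr0, fun z => q.sum (z - x), ?_, ?_⟩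
  · intro z hz
    have : z - x ∈ Metric.eball (0 : ℂ) q.radius := by
      refine Metric.eball_subset_eball (hrR.le.trans hR) ?_
      rw [Metric.eball_coe]
      simpa [dist_eq_norm] using hz
    exact ((hqs.differentiableOn.differentiableAt (Metric.isOpen_eball.mem_nhds this)).comp z
      (differentiableAt_id.sub_const _)).differentiableWithinAt
  · intro y hy
    have hy' : ‖y - x‖ < r := by
      rw [mem_ball_iff_norm, ← Complex.ofReal_sub, Complex.norm_real] at hy
      exact hy
    have h1 : y - x ∈ Metric.eball (0 : ℝ) R := by
      refine Metric.eball_subset_eball hrR.le ?_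
      rw [Metric.eball_coe]
      simpa using hy'
    have h2 : (y : ℂ) - x ∈ Metric.eball (0 : ℂ) q.radius := by
      refine Metric.eball_subset_eball (hrR.le.trans hR) ?_
      rw [Metric.eball_coe]
      simpa [dist_eq_norm] using hy
    have s1 := hp.hasSum h1
    have s2 := q.hasSum h2
    rw [add_sub_cancel] at s1
    refine s2.unique ?_
    convert s1 using 1
    ext n
    rw [FormalMultilinearSeries.apply_eq_pow_smul_coeff]
    rw [FormalMultilinearSeries.apply_eq_pow_smul_coeff]
    have : q.coeff n = p.coeff n := by
      change ContinuousMultilinearMap.mkPiRing ℂ (Fin n) (p.coeff n) 1 = _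
      simp
    rw [this, Complex.real_smul, smul_eq_mul]
    push_cast
    rfl

namespace RealAnalytic

/-- The union of the complex balls on which `f` has a local extension is a neighbourhood of `ℝ`; the
local extensions are compatible since two intersecting balls centred on the real line meet in a
convex set containing a real point. -/
theorem exists_eq_ofHol (f : RealAnalytic) :
    ∃ (U : TopologicalSpace.Opens ℂ) (g : ℂ → ℂ), (∀ x : ℝ, (x : ℂ) ∈ U) ∧
      DifferentiableOn ℂ g U ∧ ∀ x : ℝ, g x = f x := by
  choose r hr G hG hGf using fun x : ℝ =>
    exists_differentiableOn_ball_eq_of_analyticAt (f.analyticOnNhd x trivial)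
  have compat : ∀ (x y : ℝ) (z : ℂ), z ∈ Metric.ball (x : ℂ) (r x) →
      z ∈ Metric.ball (y : ℂ) (r y) → G x z = G y z := by
    intro x y z hx hy
    have hre : ∀ w : ℝ, z ∈ Metric.ball (w : ℂ) (r w) →
        ((z.re : ℝ) : ℂ) ∈ Metric.ball (w : ℂ) (r w) := by
      intro w hw
      rw [mem_ball_iff_norm, ← Complex.ofReal_sub, Complex.norm_real]
      rw [mem_ball_iff_norm] at hw
      refine lt_of_le_of_lt ?_ hw
      simpa using Complex.abs_re_le_norm (z - w)
    have hx1 := (hG x).analyticOnNhd Metric.isOpen_ball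
    have hy1 := (hG y).analyticOnNhd Metric.isOpen_ball
    refine (hx1.mono Set.inter_subset_left).eqOn_of_preconnected_of_frequently_eq
      (hy1.mono Set.inter_subset_right)
      ((convex_ball _ _).inter (convex_ball _ _)).isPreconnected
      (z₀ := ((z.re : ℝ) : ℂ)) ⟨hre x hx, hre y hy⟩ ?_ ⟨hx, hy⟩
    have ht : Tendsto (fun s : ℝ => (s : ℂ)) (𝓝[≠] z.re) (𝓝[≠] ((z.re : ℝ) : ℂ)) :=
      Complex.continuous_ofReal.continuousWithinAt.tendsto_nhdsWithin
        fun s hs => by simpa using hs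
    refine ht.frequently (Eventually.frequently ?_)
    have ho : IsOpen ((fun s : ℝ => (s : ℂ)) ⁻¹'
        (Metric.ball (x : ℂ) (r x) ∩ Metric.ball (y : ℂ) (r y))) :=
      (Metric.isOpen_ball.inter Metric.isOpen_ball).preimage Complex.continuous_ofReal
    filter_upwards [mem_nhdsWithin_of_mem_nhds (ho.mem_nhds ⟨hre x hx, hre y hy⟩)] with s hs
    rw [hGf x s hs.1, hGf y s hs.2]
  classical
  let g : ℂ → ℂ := fun z =>
    if h : ∃ x : ℝ, z ∈ Metric.ball (x : ℂ) (r x) then G h.choose z else 0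
  have hg : ∀ (x : ℝ) (z : ℂ), z ∈ Metric.ball (x : ℂ) (r x) → g z = G x z := by
    intro x z hz
    have h : ∃ x : ℝ, z ∈ Metric.ball (x : ℂ) (r x) := ⟨x, hz⟩
    simp only [g, dif_pos h]
    exact compat _ _ _ h.choose_spec hz
  refine ⟨⟨⋃ x : ℝ, Metric.ball (x : ℂ) (r x), isOpen_iUnion fun _ => Metric.isOpen_ball⟩, g,
    fun x => Set.mem_iUnion.2 ⟨x, Metric.mem_ball_self (hr x)⟩, ?_, fun x => ?_⟩
  · intro z hz
    obtain ⟨x, hx⟩ := Set.mem_iUnion.1 hz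
    have hb := Metric.isOpen_ball.mem_nhds hx
    refine (((hG x).differentiableAt hb).congr_of_eventuallyEq ?_).differentiableWithinAt
    filter_upwards [hb] with w hw using hg x w hw
  · rw [hg x x (Metric.mem_ball_self (hr x)), hGf x x (Metric.mem_ball_self (hr x))]

/-! ### The inductive limit topology -/

/-- The universal property of the locally convex inductive limit. -/
theorem continuous_of_comp_ofHol {Y : Type*} [AddCommGroup Y] [Module ℂ Y] [TopologicalSpace Y]
    [IsTopologicalAddGroup Y] [ContinuousSMul ℂ Y] [LocallyConvexSpace ℝ Y]
    (L : RealAnalytic →ₗ[ℂ] Y)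
    (h : ∀ (U : TopologicalSpace.Opens ℂ) (hU : ∀ x : ℝ, (x : ℂ) ∈ U),
      Continuous fun f => L (ofHol U hU f)) : Continuous L := by
  refine continuous_iff_le_induced.2 (sInf_le ⟨fun U hU => continuous_induced_rng.2 (h U hU), ?_,
    ?_, ?_⟩)
  · exact topologicalAddGroup_induced L
  · exact continuousSMul_induced L
  · exact LocallyConvexSpace.induced (L.restrictScalars ℝ)

@[simp] theorem sub_apply (f g : RealAnalytic) (x : ℝ) : (f - g) x = f x - g x := rfl

/-- The inclusion `A(ℝ) → C(ℝ, ℂ)` as a linear map. -/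
noncomputable def toContinuousMapₗ : RealAnalytic →ₗ[ℂ] C(ℝ, ℂ) where
  toFun f := ⟨f, continuousOn_univ.1 f.analyticOnNhd.continuousOn⟩
  map_add' _ _ := rfl
  map_smul' _ _ := rfl

theorem continuous_toContinuousMapₗ : Continuous toContinuousMapₗ :=
  continuous_of_comp_ofHol _ fun U hU =>
    (ContinuousMap.continuous_precomp
      (⟨fun x : ℝ => (⟨x, hU x⟩ : U), by fun_prop⟩ : C(ℝ, U))).comp continuous_subtype_val

/-- The continuous inclusion `A(ℝ) → C(ℝ, ℂ)`. -/
noncomputable def toContinuousMap : RealAnalytic →L[ℂ] C(ℝ, ℂ) :=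
  ⟨toContinuousMapₗ, continuous_toContinuousMapₗ⟩

instance : T2Space RealAnalytic :=
  .of_injective_continuous (f := toContinuousMap)
    (fun _ _ h => DFunLike.ext _ _ fun x => DFunLike.congr_fun h x) toContinuousMap.continuous

/-- The point evaluation `f ↦ f x`. -/
noncomputable def eval (x : ℝ) : RealAnalytic →L[ℂ] ℂ where
  toFun f := f x
  map_add' _ _ := rfl
  map_smul' _ _ := rfl
  cont := (continuous_eval_const (F := C(ℝ, ℂ)) x).comp toContinuousMap.continuous

@[simp] theorem eval_apply (x : ℝ) (f : RealAnalytic) : eval x f = f x := rfl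

end RealAnalytic

/-! ### Differentiation on `H(U)` and on `A(ℝ)` -/

/-- The extension by zero of `f ∈ H(U)` to the whole plane. -/
noncomputable def HolSpace.extend {U : TopologicalSpace.Opens ℂ} (f : HolSpace U) : ℂ → ℂ :=
  Function.extend (Subtype.val : U → ℂ) f.1 0

namespace HolSpace

variable {U : TopologicalSpace.Opens ℂ}

theorem extend_apply (f : HolSpace U) (z : U) : extend f z = f.1 z :=
  Subtype.val_injective.extend_apply _ _ _

theorem differentiableOn_extend (f : HolSpace U) : DifferentiableOn ℂ (extend f) U := by
  obtain ⟨g, hg, e⟩ := f.2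
  exact hg.congr fun z hz => (extend_apply f ⟨z, hz⟩).trans (e ⟨z, hz⟩)

/-- The element of `H(U)` given by a function that is holomorphic on `U`. -/
noncomputable def mk (g : ℂ → ℂ) (hg : DifferentiableOn ℂ g U) : HolSpace U :=
  ⟨⟨fun z : U => g z, continuousOn_iff_continuous_domRestrict.1 hg.continuousOn⟩, g, hg,
    fun _ => rfl⟩

/-- Differentiation of holomorphic functions on `U`. -/
noncomputable def derivative (f : HolSpace U) : HolSpace U :=
  mk (deriv (extend f)) ((differentiableOn_extend f).deriv U.isOpen)

/-- Locally uniform convergence of holomorphic functions passes to the derivatives. -/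
theorem continuous_derivative : Continuous (derivative : HolSpace U → HolSpace U) := by
  have : LocallyCompactSpace U := U.isOpen.locallyCompactSpace
  refine continuous_iff_continuousAt.2 fun f => ?_
  have h1 : Tendsto (fun g : HolSpace U => (g : C(U, ℂ))) (𝓝 f) (𝓝 (f : C(U, ℂ))) :=
    continuous_subtype_val.tendsto f
  rw [ContinuousMap.tendsto_iff_tendstoLocallyUniformly] at h1
  have h2 : TendstoLocallyUniformlyOn (fun g : HolSpace U => extend g) (extend f) (𝓝 f) U := by
    rw [tendstoLocallyUniformlyOn_iff_tendstoLocallyUniformly_comp_coe]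
    change TendstoLocallyUniformly (fun (g : HolSpace U) (z : U) => extend g z)
      (fun z : U => extend f z) (𝓝 f)
    simpa only [extend_apply] using h1
  have h3 := h2.deriv (Eventually.of_forall differentiableOn_extend) U.isOpen
  rw [tendstoLocallyUniformlyOn_iff_tendstoLocallyUniformly_comp_coe] at h3
  refine tendsto_subtype_rng.2 ?_
  rw [ContinuousMap.tendsto_iff_tendstoLocallyUniformly]
  exact h3

end HolSpace

namespace RealAnalytic

theorem ofHol_mk_apply {U : TopologicalSpace.Opens ℂ} (hU : ∀ x : ℝ, (x : ℂ) ∈ U) (g : ℂ → ℂ)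
    (hg : DifferentiableOn ℂ g U) (x : ℝ) : ofHol U hU (HolSpace.mk g hg) x = g x := rfl

theorem differentiableAt (f : RealAnalytic) (x : ℝ) : DifferentiableAt ℝ f x :=
  (f.analyticOnNhd x trivial).differentiableAt

/-- A linear operator on `A(ℝ)` that is induced by continuous maps of the steps `H(U)` is
continuous. -/
theorem continuous_of_holSpace (L : RealAnalytic →ₗ[ℂ] RealAnalytic)
    (h : ∀ (U : TopologicalSpace.Opens ℂ) (hU : ∀ x : ℝ, (x : ℂ) ∈ U),
      ∃ (V : TopologicalSpace.Opens ℂ) (hV : ∀ x : ℝ, (x : ℂ) ∈ V) (Φ : HolSpace U → HolSpace V),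
        Continuous Φ ∧ ∀ f x, L (ofHol U hU f) x = ofHol V hV (Φ f) x) : Continuous L := by
  refine continuous_of_comp_ofHol L fun U hU => ?_
  obtain ⟨V, hV, Φ, hΦ, e⟩ := h U hU
  have : (fun f => L (ofHol U hU f)) = fun f => ofHol V hV (Φ f) :=
    funext fun f => DFunLike.ext _ _ (e f)
  rw [this]
  exact (continuous_ofHol V hV).comp hΦ

/-- Differentiation on `A(ℝ)` as a linear map. -/
noncomputable def derivₗ : RealAnalytic →ₗ[ℂ] RealAnalytic where
  toFun f := ⟨deriv f, f.analyticOnNhd.deriv⟩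
  map_add' f g := DFunLike.ext _ _ fun x => deriv_add (f.differentiableAt x) (g.differentiableAt x)
  map_smul' c f := DFunLike.ext _ _ fun x => deriv_const_mul c (f.differentiableAt x)

theorem continuous_derivₗ : Continuous derivₗ := by
  refine continuous_of_holSpace _
    fun U hU => ⟨U, hU, HolSpace.derivative, HolSpace.continuous_derivative, fun f x => ?_⟩
  change deriv (fun y : ℝ => f.1 ⟨(y : ℂ), hU y⟩) x = deriv (HolSpace.extend f) x
  have : (fun y : ℝ => f.1 ⟨(y : ℂ), hU y⟩) = fun y : ℝ => HolSpace.extend f y :=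
    funext fun y => (HolSpace.extend_apply f ⟨y, hU y⟩).symm
  rw [this]
  exact ((HolSpace.differentiableOn_extend f).differentiableAt
    (U.isOpen.mem_nhds (hU x))).hasDerivAt.comp_ofReal.deriv

/-- Differentiation on `A(ℝ)` as a continuous linear map. -/
noncomputable def derivCLM : RealAnalytic →L[ℂ] RealAnalytic := ⟨derivₗ, continuous_derivₗ⟩

@[simp] theorem derivCLM_apply (f : RealAnalytic) (x : ℝ) : derivCLM f x = deriv f x := rfl

/-- Multiplication by the identity function on `A(ℝ)`. -/
noncomputable def mulX : RealAnalytic →ₗ[ℂ] RealAnalytic where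
  toFun f := ⟨fun x => (x : ℂ) * f x, fun x hx =>
    (Complex.ofRealCLM.analyticAt x).mul (f.analyticOnNhd x hx)⟩
  map_add' _ _ := DFunLike.ext _ _ fun _ => mul_add _ _ _
  map_smul' _ _ := DFunLike.ext _ _ fun _ => mul_left_comm _ _ _

@[simp] theorem mulX_apply (f : RealAnalytic) (x : ℝ) : mulX f x = x * f x := rfl

theorem continuous_mulX : Continuous mulX := by
  refine continuous_of_holSpace _ fun U hU => ⟨U, hU,
    fun f => HolSpace.mk (fun z => z * HolSpace.extend f z)
      (differentiableOn_id.mul (HolSpace.differentiableOn_extend f)),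
    ?_, fun f x => ?_⟩
  · have : LocallyCompactSpace U := U.isOpen.locallyCompactSpace
    have h : Continuous fun f : HolSpace U =>
        (⟨fun z : U => (z : ℂ), continuous_subtype_val⟩ : C(U, ℂ)) * f.1 :=
      continuous_const.mul continuous_subtype_val
    refine continuous_induced_rng.2 (h.congr fun f => ?_)
    ext z
    exact congrArg (z.1 * ·) (HolSpace.extend_apply f z).symm
  · exact congrArg ((x : ℂ) * ·) (HolSpace.extend_apply f ⟨x, hU x⟩).symm

theorem euler_eq (a b : ℂ) (f : RealAnalytic) :
    euler a b f = a • mulX (derivCLM f) + b • f :=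
  DFunLike.ext _ _ fun x => by simp [mul_assoc]

theorem continuous_euler (a b : ℂ) : Continuous (euler a b) := by
  simp only [funext (euler_eq a b)]
  exact ((continuous_mulX.comp derivCLM.continuous).const_smul a).add (continuous_id.const_smul b)

/-! ### Taylor coefficients at `0` -/

theorem derivCLM_mulX (f : RealAnalytic) : derivCLM (mulX f) = mulX (derivCLM f) + f := by
  refine DFunLike.ext _ _ fun x => ?_
  have h : HasDerivAt (fun y : ℝ => (y : ℂ) * f y) (1 * f x + x * deriv f x) x :=
    (Complex.ofRealCLM.hasDerivAt (x := x)).mul (f.differentiableAt x).hasDerivAt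
  change deriv (fun y : ℝ => (y : ℂ) * f y) x = x * deriv f x + f x
  rw [h.deriv]
  ring

/-- The functional `f ↦ f⁽ⁿ⁾(0)`, without the factor `1 / n!`. -/
noncomputable def taylorCoeff (n : ℕ) : RealAnalytic →L[ℂ] ℂ := (eval 0).comp (derivCLM ^ n)

theorem derivCLM_pow_succ_mulX (n : ℕ) (f : RealAnalytic) :
    (derivCLM ^ (n + 1)) (mulX f) =
      mulX ((derivCLM ^ (n + 1)) f) + ((n : ℂ) + 1) • (derivCLM ^ n) f := by
  induction n with
  | zero => simpa using derivCLM_mulX f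
  | succ n ih =>
    rw [pow_succ' derivCLM (n + 1), mul_apply_eq_comp, ih, map_add, derivCLM_mulX,
      map_smul, ← mul_apply_eq_comp, ← mul_apply_eq_comp, ← pow_succ',
      ← pow_succ', add_assoc]
    congr 1
    push_cast
    module

theorem taylorCoeff_zero_mulX (f : RealAnalytic) : taylorCoeff 0 (mulX f) = 0 := by
  simp [taylorCoeff]

theorem taylorCoeff_succ_mulX (n : ℕ) (f : RealAnalytic) :
    taylorCoeff (n + 1) (mulX f) = ((n : ℂ) + 1) * taylorCoeff n f := by
  change (derivCLM ^ (n + 1)) (mulX f) 0 = ((n : ℂ) + 1) * (derivCLM ^ n) f 0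
  rw [derivCLM_pow_succ_mulX]
  simp only [add_apply, mulX_apply, smul_apply, Complex.ofReal_zero, zero_mul, zero_add]

theorem taylorCoeff_derivCLM (n : ℕ) (f : RealAnalytic) :
    taylorCoeff n (derivCLM f) = taylorCoeff (n + 1) f := by
  simp [taylorCoeff, pow_succ]

/-- The monomials are eigenvectors of the Euler operator, so the Taylor coefficients at `0` are
eigenvectors of its transpose. -/
theorem taylorCoeff_euler (a b : ℂ) (n : ℕ) (f : RealAnalytic) :
    taylorCoeff n (euler a b f) = (a * n + b) * taylorCoeff n f := by
  rw [euler_eq, map_add, map_smul, map_smul, smul_eq_mul, smul_eq_mul]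
  cases n with
  | zero => simp [taylorCoeff_zero_mulX]
  | succ n =>
    rw [taylorCoeff_succ_mulX, taylorCoeff_derivCLM]
    push_cast
    ring

/-- By the identity theorem, the Taylor coefficients at `0` determine the function on `ℝ`. -/
theorem eq_zero_of_taylorCoeff_eq_zero {f : RealAnalytic} (h : ∀ n, taylorCoeff n f = 0) :
    f = 0 := by
  have hD : ∀ n, ⇑((derivCLM ^ n) f) = iteratedDeriv n f := by
    intro n
    induction n with
    | zero => rfl
    | succ n ih =>
      rw [pow_succ', mul_apply_eq_comp, iteratedDeriv_succ, ← ih]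
      rfl
  have h0 : analyticOrderAt f 0 = ⊤ := by
    rw [ENat.eq_top_iff_forall_ge]
    intro n
    rw [natCast_le_analyticOrderAt_iff_iteratedDeriv_eq_zero (f.analyticOnNhd 0 trivial)]
    intro i _
    rw [← hD]
    exact h i
  rw [analyticOrderAt_eq_top] at h0
  have := f.analyticOnNhd.eqOn_zero_of_preconnected_of_eventuallyEq_zero isPreconnected_univ
    (Set.mem_univ 0) h0
  exact DFunLike.ext _ _ fun x => this (Set.mem_univ x)

end RealAnalytic

/-! ### Orbits of a generated semigroup -/

/-- A one-sided version of the uniqueness theorem for `ψ' = c ψ`. -/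
theorem eq_exp_mul_of_hasDerivWithinAt_Ici {c : ℂ} {ψ : ℝ → ℂ} (hψ : Continuous ψ)
    (h : ∀ s, 0 ≤ s → HasDerivWithinAt ψ (c * ψ s) (Set.Ici s) s) {t : ℝ} (ht : 0 ≤ t) :
    ψ t = Complex.exp (c * t) * ψ 0 := by
  have he : ∀ s : ℝ, HasDerivAt (fun s : ℝ => Complex.exp (-c * s))
      (Complex.exp (-c * s) * (-c * 1)) s := fun s =>
    ((Complex.ofRealCLM.hasDerivAt (x := s)).const_mul (-c)).cexp
  have hconst := constant_of_has_deriv_right_zero (a := 0) (b := t)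
    (f := fun s : ℝ => Complex.exp (-c * s) * ψ s)
    (by fun_prop)
    (fun s hs =>
      ((he s).hasDerivWithinAt.mul (h s hs.1)).congr_deriv (by ring)) t ⟨ht, le_rfl⟩
  simp only [Complex.ofReal_zero, mul_zero, Complex.exp_zero, one_mul] at hconst
  rw [← hconst, ← mul_assoc, ← Complex.exp_add]
  simp

section Orbit

variable {X : Type*} [AddCommGroup X] [Module ℂ X] [TopologicalSpace X] {M : X →ₗ[ℂ] X}
  {T : ℝ≥0 → X →L[ℂ] X}

theorem Generates.continuous_orbit (h : Generates M T) (f : X) :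
    Continuous fun s : ℝ => T s.toNNReal f :=
  (continuous_iff_continuousAt.2 fun s => h.1.tendsto s f).comp continuous_real_toNNReal

/-- The orbits of a semigroup with an everywhere defined generator `M` solve `u' = M u`, with
right derivatives. -/
theorem Generates.tendsto_orbit (h : Generates M T) (f : X) {s : ℝ} (hs : 0 ≤ s) :
    Tendsto (fun s' : ℝ => ((s' - s : ℝ) : ℂ)⁻¹ • (T s'.toNNReal f - T s.toNNReal f)) (𝓝[>] s)
      (𝓝 (M (T s.toNNReal f))) := by
  have hg : (T s.toNNReal f, M (T s.toNNReal f)) ∈ generatorGraph T := by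
    rw [h.2]
    rfl
  have hsub : Tendsto (fun s' : ℝ => (s' - s).toNNReal) (𝓝[>] s) (𝓝[>] 0) := by
    refine tendsto_nhdsWithin_iff.2 ⟨?_, ?_⟩
    · have : Continuous fun s' : ℝ => (s' - s).toNNReal :=
        continuous_real_toNNReal.comp (continuous_id.sub continuous_const)
      simpa using (this.tendsto s).mono_left nhdsWithin_le_nhds
    · filter_upwards [self_mem_nhdsWithin] with s' hs'
      simpa using hs'
  refine (Tendsto.comp hg hsub).congr' ?_
  filter_upwards [self_mem_nhdsWithin] with s' hs'
  have hs0 : 0 ≤ s' - s := sub_nonneg.2 (le_of_lt hs')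
  have hadd : s'.toNNReal = (s' - s).toNNReal + s.toNNReal := by
    rw [← Real.toNNReal_add hs0 hs, sub_add_cancel]
  simp only [Function.comp_apply, Real.coe_toNNReal _ hs0]
  rw [hadd, h.1.map_add]
  rfl

end Orbit

namespace RealAnalytic

/-- The product rule for the evaluation of an orbit along a differentiable curve in `ℝ`. It needs
the convergence of the difference quotients in `C(ℝ, ℂ)`, not only pointwise. -/
theorem hasDerivWithinAt_eval_orbit {M : RealAnalytic →ₗ[ℂ] RealAnalytic}
    {T : ℝ≥0 → RealAnalytic →L[ℂ] RealAnalytic} (h : Generates M T) (f : RealAnalytic)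
    {y : ℝ → ℝ} {y' s : ℝ} (hy : HasDerivAt y y' s) (hs : 0 ≤ s) :
    HasDerivWithinAt (fun s' : ℝ => T s'.toNNReal f (y s'))
      (M (T s.toNNReal f) (y s) + y' * deriv (T s.toNNReal f) (y s)) (Set.Ici s) s := by
  have h1 : Tendsto
      (fun s' : ℝ => (((s' - s : ℝ) : ℂ)⁻¹ • (T s'.toNNReal f - T s.toNNReal f)) (y s'))
      (𝓝[>] s) (𝓝 (M (T s.toNNReal f) (y s))) := by
    have hC := (toContinuousMap.continuous.tendsto _).comp (h.tendsto_orbit f hs)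
    exact ((continuous_eval (F := C(ℝ, ℂ))).tendsto (_, y s)).comp
      (hC.prodMk_nhds (hy.continuousAt.tendsto.mono_left nhdsWithin_le_nhds))
  have h2 : HasDerivAt (fun s' : ℝ => T s.toNNReal f (y s'))
      (y' * deriv (T s.toNNReal f) (y s)) s := by
    have := ((T s.toNNReal f).differentiableAt (y s)).hasDerivAt.scomp s hy
    rwa [Complex.real_smul] at this
  rw [← hasDerivWithinAt_Ioi_iff_Ici,
    hasDerivWithinAt_iff_tendsto_slope' (Set.self_notMem_Ioi (a := s))]
  have h3 := (hasDerivWithinAt_iff_tendsto_slope' (Set.self_notMem_Ioi (a := s))).1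
    h2.hasDerivWithinAt
  refine (h1.add h3).congr fun s' => ?_
  simp only [slope_def_module, Complex.real_smul, smul_apply, sub_apply, Complex.ofReal_inv]
  ring

/-- The Taylor coefficients at `0` of `T t f` are determined by those of `f`. -/
theorem taylorCoeff_orbit {a b : ℂ} {T : ℝ≥0 → RealAnalytic →L[ℂ] RealAnalytic}
    (h : Generates (euler a b) T) (n : ℕ) (f : RealAnalytic) (t : ℝ≥0) :
    taylorCoeff n (T t f) = Complex.exp ((a * n + b) * t) * taylorCoeff n f := by
  have := eq_exp_mul_of_hasDerivWithinAt_Ici (c := a * n + b)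
    (ψ := fun s : ℝ => taylorCoeff n (T s.toNNReal f))
    ((taylorCoeff n).continuous.comp (h.continuous_orbit f)) (fun s hs => ?_) t.2
  · simpa [h.1.map_zero] using this
  · rw [← hasDerivWithinAt_Ioi_iff_Ici,
      hasDerivWithinAt_iff_tendsto_slope' (Set.self_notMem_Ioi (a := s)), ← taylorCoeff_euler]
    refine (((taylorCoeff n).continuous.tendsto _).comp (h.tendsto_orbit f hs)).congr fun s' => ?_
    simp [slope_def_module, Complex.real_smul]

/-! ### Uniqueness -/

/-- The operator with `a` real generates at most one semigroup: along the characteristic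
`s ↦ exp (r (t - s)) x` an orbit solves a scalar equation. -/
theorem eq_of_generates_euler {r : ℝ} {b : ℂ} {T : ℝ≥0 → RealAnalytic →L[ℂ] RealAnalytic}
    (h : Generates (euler r b) T) (t : ℝ≥0) (f : RealAnalytic) (x : ℝ) :
    T t f x = Complex.exp (b * ((t : ℝ) : ℂ)) * f (Real.exp ((t : ℝ) * r) * x) := by
  have hy : ∀ s : ℝ, HasDerivAt (fun s : ℝ => Real.exp ((t - s) * r) * x)
      (-(r * (Real.exp ((t - s) * r) * x))) s := fun s => by
    exact (((((hasDerivAt_id' s).const_sub (t : ℝ)).mul_const r).exp).mul_const x).congr_deriv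
      (by ring)
  have := eq_exp_mul_of_hasDerivWithinAt_Ici (c := b)
    (ψ := fun s : ℝ => T s.toNNReal f (Real.exp ((t - s) * r) * x)) ?_ (fun s hs => ?_) t.2
  · simpa [h.1.map_zero] using this
  · have hC : Continuous fun s : ℝ => toContinuousMap (T s.toNNReal f) :=
      toContinuousMap.continuous.comp (h.continuous_orbit f)
    exact hC.eval (by fun_prop)
  · convert hasDerivWithinAt_eval_orbit h f (hy s) hs using 1
    rw [euler_apply]
    push_cast
    ring

/-! ### Necessity of a real coefficient -/

/-- Suppose that `a` is not real and pick `t` with `w = exp (a t)` not real. The function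
`f x = 1 / (x - w)` is real analytic, but the Taylor series of `T t f` at `0` is that of
`exp (b t) w⁻¹ / (x - 1)`, which has a pole on the real line. -/
theorem im_eq_zero_of_generates_euler {a b : ℂ} {T : ℝ≥0 → RealAnalytic →L[ℂ] RealAnalytic}
    (h : Generates (euler a b) T) : a.im = 0 := by
  by_contra ha
  obtain ⟨t, ht⟩ : ∃ t : ℝ≥0, (Complex.exp (a * t)).im ≠ 0 := by
    refine ⟨(1 / |a.im|).toNNReal, ?_⟩
    have h1 : (1 : ℝ) < Real.pi := by linarith [Real.pi_gt_three]
    rw [Complex.exp_im, Complex.im_mul_ofReal, Real.coe_toNNReal _ (by positivity), mul_one_div]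
    refine mul_ne_zero (Real.exp_pos _).ne' ?_
    have hs : 0 < Real.sin 1 := Real.sin_pos_of_pos_of_lt_pi one_pos h1
    rcases lt_or_gt_of_ne ha with hn | hp
    · rw [abs_of_neg hn, div_neg, div_self ha, Real.sin_neg]
      exact neg_ne_zero.2 hs.ne'
    · rw [abs_of_pos hp, div_self ha]
      exact hs.ne'
  set w := Complex.exp (a * t) with hw
  have hxw : ∀ x : ℝ, (x : ℂ) - w ≠ 0 := fun x e => ht (by
    rw [← sub_eq_zero.1 e]
    exact Complex.ofReal_im x)
  let f : RealAnalytic := ⟨fun x => ((x : ℂ) - w)⁻¹, fun x _ =>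
    ((Complex.ofRealCLM.analyticAt x).sub analyticAt_const).inv (hxw x)⟩
  have hf : derivCLM (mulX f - w • f) = 0 := by
    refine DFunLike.ext _ _ fun x => ?_
    have : ⇑(mulX f - w • f) = fun _ => (1 : ℂ) := funext fun y => by
      change (y : ℂ) * ((y : ℂ) - w)⁻¹ - w * ((y : ℂ) - w)⁻¹ = 1
      rw [← sub_mul, mul_inv_cancel₀ (hxw y)]
    rw [derivCLM_apply, this, deriv_const]
    rfl
  have hrec : ∀ n : ℕ, ((n : ℂ) + 1) * taylorCoeff n f = w * taylorCoeff (n + 1) f := fun n => by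
    have := taylorCoeff_derivCLM n (mulX f - w • f)
    rw [hf, map_zero, map_sub, map_smul, taylorCoeff_succ_mulX, smul_eq_mul] at this
    exact sub_eq_zero.1 this.symm
  -- The scaling of the coefficients moves the pole from `w` to `1`.
  have hg : derivCLM (mulX (T t f) - T t f) = 0 := by
    refine eq_zero_of_taylorCoeff_eq_zero fun n => ?_
    rw [taylorCoeff_derivCLM, map_sub, taylorCoeff_succ_mulX, taylorCoeff_orbit h,
      taylorCoeff_orbit h]
    have hexp : Complex.exp ((a * ((n + 1 : ℕ) : ℂ) + b) * t) =
        Complex.exp ((a * n + b) * t) * w := by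
      rw [hw, ← Complex.exp_add]
      congr 1
      push_cast
      ring
    rw [hexp]
    linear_combination Complex.exp ((a * n + b) * t) * hrec n
  have hconst : (mulX (T t f) - T t f) 1 = (mulX (T t f) - T t f) 0 :=
    is_const_of_deriv_eq_zero (fun x => (mulX (T t f) - T t f).differentiableAt x)
      (fun x => DFunLike.congr_fun hg x) 1 0
  have h0 : T t f 0 = Complex.exp (b * t) * (-w)⁻¹ := by
    have := taylorCoeff_orbit h 0 f t
    rw [Nat.cast_zero, mul_zero, zero_add] at this
    refine this.trans ?_
    change Complex.exp (b * t) * (((0 : ℝ) : ℂ) - w)⁻¹ = _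
    rw [Complex.ofReal_zero, zero_sub]
  have hw0 : w ≠ 0 := Complex.exp_ne_zero _
  simp [h0, hw0, Complex.exp_ne_zero] at hconst

end RealAnalytic

/-! ### The semigroup of weighted dilations -/

/-- If `y` is differentiable in `t` with derivative `w` jointly continuous in `(t, z)`, then the
difference quotients of `y` at `t = 0`, completed by `w 0`, are jointly continuous in `(t, z)`. -/
theorem continuousOn_differenceQuotient {α : Type*} [PseudoMetricSpace α] {V : Set α}
    {y w : ℝ → α → ℂ}
    (hy : ContinuousOn (Function.uncurry y) (Set.Icc 0 1 ×ˢ V))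
    (hw : ContinuousOn (Function.uncurry w) (Set.Icc 0 1 ×ˢ V))
    (hd : ∀ z ∈ V, ∀ t ∈ Set.Icc (0 : ℝ) 1, HasDerivAt (fun s => y s z) (w t z) t) :
    ContinuousOn (Function.uncurry fun (t : ℝ) z =>
      if t = 0 then w 0 z else (t : ℂ)⁻¹ * (y t z - y 0 z)) (Set.Icc 0 1 ×ˢ V) := by
  rintro ⟨t₀, z₀⟩ ⟨ht₀, hz₀⟩
  rcases eq_or_ne t₀ 0 with rfl | hne
  · rw [Metric.continuousWithinAt_iff]
    intro ε hε
    obtain ⟨δ, hδ, hδw⟩ := Metric.continuousWithinAt_iff.1 (hw (0, z₀) ⟨ht₀, hz₀⟩) (ε / 2)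
      (half_pos hε)
    refine ⟨δ, hδ, ?_⟩
    rintro ⟨t, z⟩ ⟨ht, hz⟩ hdist
    simp only [Prod.dist_eq, max_lt_iff, Real.dist_eq, sub_zero] at hdist
    have key : ∀ s ∈ Set.Icc (0 : ℝ) t, ‖w s z - w 0 z₀‖ ≤ ε / 2 := by
      intro s hs
      rw [← dist_eq_norm]
      refine (hδw (x := (s, z)) ⟨⟨hs.1, hs.2.trans ht.2⟩, hz⟩ ?_).le
      simp only [Prod.dist_eq, max_lt_iff, Real.dist_eq, sub_zero]
      refine ⟨?_, hdist.2⟩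
      rw [abs_of_nonneg hs.1]
      exact (hs.2.trans (le_abs_self t)).trans_lt hdist.1
    simp only [Function.uncurry_apply_pair, if_true, dist_eq_norm]
    split_ifs with h0
    · exact (key 0 ⟨le_rfl, ht.1⟩).trans_lt (half_lt_self hε)
    · have htpos : 0 < t := lt_of_le_of_ne ht.1 (Ne.symm h0)
      have htc : (t : ℂ) ≠ 0 := Complex.ofReal_ne_zero.2 h0
      -- The mean value inequality for `s ↦ y s z - s * w 0 z₀` on `[0, t]`.
      have hmv := norm_image_sub_le_of_norm_deriv_le_segment' (a := 0) (b := t)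
        (f := fun s : ℝ => y s z - s * w 0 z₀) (f' := fun s => w s z - 1 * w 0 z₀)
        (fun s hs => ((hd z hz s ⟨hs.1, hs.2.trans ht.2⟩).sub
          ((Complex.ofRealCLM.hasDerivAt (x := s)).mul_const _)).hasDerivWithinAt)
        (fun s hs => by simpa using key s ⟨hs.1, hs.2.le⟩) t ⟨ht.1, le_rfl⟩
      have e : (t : ℂ)⁻¹ * (y t z - y 0 z) - w 0 z₀ =
          (t : ℂ)⁻¹ * (y t z - t * w 0 z₀ - (y 0 z - ((0 : ℝ) : ℂ) * w 0 z₀)) := by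
        rw [Complex.ofReal_zero]
        field_simp
        ring
      rw [e, norm_mul, norm_inv, Complex.norm_real, Real.norm_of_nonneg ht.1,
        inv_mul_lt_iff₀ htpos]
      refine hmv.trans_lt ?_
      rw [sub_zero]
      nlinarith
  · have hy0 : ContinuousOn (fun p : ℝ × α => y 0 p.2) (Set.Icc 0 1 ×ˢ V) :=
      hy.comp (f := fun p : ℝ × α => ((0 : ℝ), p.2)) (by fun_prop)
        fun p hp => ⟨⟨le_rfl, zero_le_one⟩, hp.2⟩
    have hinv : ContinuousWithinAt (fun p : ℝ × α => (p.1 : ℂ)⁻¹) (Set.Icc 0 1 ×ˢ V) (t₀, z₀) :=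
      ((Complex.continuous_ofReal.comp continuous_fst).continuousAt.inv₀
        (Complex.ofReal_ne_zero.2 hne)).continuousWithinAt
    refine (hinv.mul ((hy (t₀, z₀) ⟨ht₀, hz₀⟩).sub (hy0 (t₀, z₀) ⟨ht₀, hz₀⟩))).congr_of_eventuallyEq
      ?_ (if_neg hne)
    have : ∀ᶠ p : ℝ × α in 𝓝 (t₀, z₀), p.1 ≠ 0 := continuous_fst.continuousAt.eventually_ne hne
    filter_upwards [nhdsWithin_le_nhds this] with p hp using if_neg hp

namespace RealAnalytic

/-- A curve in `A(ℝ)` is continuous if it factors through a step `H(V)` and is jointly continuous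
there. -/
theorem continuousOn_of_hol {V : TopologicalSpace.Opens ℂ} (hV : ∀ x : ℝ, (x : ℂ) ∈ V) {K : Set ℝ}
    {u : ℝ → ℂ → ℂ} (hd : ∀ t ∈ K, DifferentiableOn ℂ (u t) V)
    (hc : ContinuousOn (Function.uncurry u) (K ×ˢ (V : Set ℂ))) {φ : ℝ → RealAnalytic}
    (e : ∀ t ∈ K, ∀ x : ℝ, φ t x = u t x) : ContinuousOn φ K := by
  rw [continuousOn_iff_continuous_domRestrict]
  have h : Continuous fun t : K => HolSpace.mk (U := V) (u t) (hd t t.2) :=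
    continuous_induced_rng.2 (ContinuousMap.continuous_of_continuous_uncurry _
      (hc.comp_continuous (f := fun p : K × V => ((p.1 : ℝ), (p.2 : ℂ))) (by fun_prop)
        fun p => ⟨p.1.2, p.2.2⟩))
  refine ((continuous_ofHol V hV).comp h).congr fun t => ?_
  exact DFunLike.ext _ _ fun x => (e t t.2 x).symm

/-- The weighted dilation `f ↦ exp (b t) f (exp (t r) ·)`. -/
noncomputable def dilation (r : ℝ) (b : ℂ) (t : ℝ) : RealAnalytic →ₗ[ℂ] RealAnalytic where
  toFun f := ⟨fun x => Complex.exp (b * t) * f (Real.exp (t * r) * x), fun _ _ =>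
    analyticAt_const.mul
      ((f.analyticOnNhd _ trivial).fun_comp (analyticAt_const.mul analyticAt_id))⟩
  map_add' _ _ := DFunLike.ext _ _ fun _ => mul_add _ _ _
  map_smul' _ _ := DFunLike.ext _ _ fun _ => mul_left_comm _ _ _

theorem continuous_dilation (r : ℝ) (b : ℂ) (t : ℝ) : Continuous (dilation r b t) := by
  refine continuous_of_holSpace _ fun U hU => ?_
  let V : TopologicalSpace.Opens ℂ :=
    ⟨(fun z : ℂ => (Real.exp (t * r) : ℂ) * z) ⁻¹' U, U.isOpen.preimage (by fun_prop)⟩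
  let j : C(V, U) := ⟨fun z => ⟨(Real.exp (t * r) : ℂ) * z, z.2⟩, by fun_prop⟩
  refine ⟨V, fun x => ?_, fun f => HolSpace.mk (fun z =>
    Complex.exp (b * t) * HolSpace.extend f ((Real.exp (t * r) : ℂ) * z)) ?_, ?_, fun f x => ?_⟩
  · change (Real.exp (t * r) : ℂ) * x ∈ U
    rw [← Complex.ofReal_mul]
    exact hU _
  · exact ((HolSpace.differentiableOn_extend f).comp (differentiableOn_id.const_mul _)
      fun z hz => hz).const_mul _
  · have hj : Continuous fun f : HolSpace U => f.1.comp j :=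
      (ContinuousMap.continuous_precomp j).comp continuous_subtype_val
    have h : Continuous fun f : HolSpace U => Complex.exp (b * t) • f.1.comp j :=
      (continuous_const_smul _).comp hj
    refine continuous_induced_rng.2 (h.congr fun f => ?_)
    ext z
    exact congrArg (Complex.exp (b * t) * ·) (HolSpace.extend_apply f (j z)).symm
  · rw [ofHol_mk_apply, ← Complex.ofReal_mul]
    exact congrArg (Complex.exp (b * t) * ·) (HolSpace.extend_apply f ⟨_, hU _⟩).symm

/-- For `t` in a compact set, the dilates of `f` extend holomorphically to a common neighbourhood
of `ℝ`. -/
theorem exists_opens_forall_dilate_mem (r : ℝ) {U : TopologicalSpace.Opens ℂ}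
    (hU : ∀ x : ℝ, (x : ℂ) ∈ U) {K : Set ℝ} (hK : IsCompact K) :
    ∃ V : TopologicalSpace.Opens ℂ, (∀ x : ℝ, (x : ℂ) ∈ V) ∧
      ∀ t ∈ K, ∀ z ∈ V, (Real.exp (t * r) : ℂ) * z ∈ U := by
  refine ⟨⟨{z | ∀ t ∈ K, (Real.exp (t * r) : ℂ) * z ∈ U}, ?_⟩, fun x t _ => ?_,
    fun t ht z hz => hz t ht⟩
  · rw [isOpen_iff_eventually]
    intro z hz
    refine hK.eventually_forall_of_forall_eventually fun t ht => ?_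
    have hc : Continuous fun p : ℂ × ℝ => (Real.exp (p.2 * r) : ℂ) * p.1 := by fun_prop
    exact hc.continuousAt.eventually (U.isOpen.mem_nhds (hz t ht))
  · rw [← Complex.ofReal_mul]
    exact hU _

section HolomorphicExtension

variable {r : ℝ} {b : ℂ} {U : TopologicalSpace.Opens ℂ} {g : ℂ → ℂ} {V : Set ℂ} {K : Set ℝ}

theorem continuousOn_comp_dilate (hg : ContinuousOn g U)
    (hV : ∀ t ∈ K, ∀ z ∈ V, (Real.exp (t * r) : ℂ) * z ∈ U) :
    ContinuousOn (fun p : ℝ × ℂ => g ((Real.exp (p.1 * r) : ℂ) * p.2)) (K ×ˢ V) :=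
  hg.comp (by fun_prop) fun p hp => hV p.1 hp.1 p.2 hp.2

theorem differentiableOn_dilate {t : ℝ} (hg : DifferentiableOn ℂ g U)
    (hV : ∀ z ∈ V, (Real.exp (t * r) : ℂ) * z ∈ U) :
    DifferentiableOn ℂ (fun z => Complex.exp (b * t) * g ((Real.exp (t * r) : ℂ) * z)) V :=
  (hg.comp (differentiableOn_id.const_mul _) hV).const_mul _

end HolomorphicExtension

theorem continuous_dilation_param (r : ℝ) (b : ℂ) (f : RealAnalytic) :
    Continuous fun t => dilation r b t f := by
  refine continuous_iff_continuousAt.2 fun s => ?_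
  obtain ⟨U, g, hU, hg, hgf⟩ := f.exists_eq_ofHol
  obtain ⟨V, hV, hVU⟩ :=
    exists_opens_forall_dilate_mem r hU (isCompact_Icc (a := s - 1) (b := s + 1))
  refine ContinuousOn.continuousAt (s := Set.Icc (s - 1) (s + 1)) ?_
    (Icc_mem_nhds (by linarith) (by linarith))
  refine continuousOn_of_hol hV
    (u := fun t z => Complex.exp (b * t) * g ((Real.exp (t * r) : ℂ) * z))
    (fun t ht => differentiableOn_dilate hg (hVU t ht)) ?_ fun t _ x => ?_
  · exact ContinuousOn.mul (by fun_prop) (continuousOn_comp_dilate hg.continuousOn hVU)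
  · rw [← Complex.ofReal_mul, hgf]
    rfl

theorem tendsto_differenceQuotient_dilation (r : ℝ) (b : ℂ) (f : RealAnalytic) :
    Tendsto (fun t : ℝ => (t : ℂ)⁻¹ • (dilation r b t f - f)) (𝓝[>] 0) (𝓝 (euler r b f)) := by
  obtain ⟨U, g, hU, hg, hgf⟩ := f.exists_eq_ofHol
  obtain ⟨V, hV, hVU⟩ := exists_opens_forall_dilate_mem r hU (isCompact_Icc (a := (0 : ℝ)) (b := 1))
  have h0 : (0 : ℝ) ∈ Set.Icc (0 : ℝ) 1 := ⟨le_rfl, zero_le_one⟩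
  have hdg : DifferentiableOn ℂ (deriv g) U := hg.deriv U.isOpen
  have hVU0 : ∀ z ∈ V, z ∈ U := fun z hz => by simpa using hVU 0 h0 z hz
  let y : ℝ → ℂ → ℂ := fun t z => Complex.exp (b * t) * g ((Real.exp (t * r) : ℂ) * z)
  let w : ℝ → ℂ → ℂ := fun t z => Complex.exp (b * t) *
    (b * g ((Real.exp (t * r) : ℂ) * z) +
      (r * ((Real.exp (t * r) : ℂ) * z)) * deriv g ((Real.exp (t * r) : ℂ) * z))
  have hy0 : ∀ z, y 0 z = g z := fun z => by simp [y]
  have hw0 : ∀ z, w 0 z = b * g z + r * z * deriv g z := fun z => by simp [w]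
  have hyc : ContinuousOn (Function.uncurry y) (Set.Icc 0 1 ×ˢ (V : Set ℂ)) :=
    ContinuousOn.mul (by fun_prop) (continuousOn_comp_dilate hg.continuousOn hVU)
  have hwc : ContinuousOn (Function.uncurry w) (Set.Icc 0 1 ×ˢ (V : Set ℂ)) :=
    ContinuousOn.mul (by fun_prop)
      ((continuousOn_const.mul (continuousOn_comp_dilate hg.continuousOn hVU)).add
        (ContinuousOn.mul (by fun_prop) (continuousOn_comp_dilate hdg.continuousOn hVU)))
  have hyw : ∀ z ∈ (V : Set ℂ), ∀ t ∈ Set.Icc (0 : ℝ) 1,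
      HasDerivAt (fun s => y s z) (w t z) t := by
    intro z hz t ht
    have he : HasDerivAt (fun s : ℝ => Complex.exp (b * s)) (Complex.exp (b * t) * (b * 1)) t :=
      ((Complex.ofRealCLM.hasDerivAt (x := t)).const_mul b).cexp
    have hs : HasDerivAt (fun s : ℝ => (Real.exp (s * r) : ℂ) * z)
        (((Real.exp (t * r) * (1 * r) : ℝ) : ℂ) * z) t :=
      (((hasDerivAt_id' t).mul_const r).exp.ofReal_comp).mul_const z
    have hc := (hg.differentiableAt (U.isOpen.mem_nhds (hVU t ht z hz))).hasDerivAt.comp t hs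
    refine (he.mul hc).congr_deriv ?_
    simp only [w, Function.comp_apply]
    push_cast
    ring
  have hcont := continuousOn_of_hol hV (K := Set.Icc 0 1)
    (u := fun t z => if t = 0 then w 0 z else (t : ℂ)⁻¹ * (y t z - y 0 z))
    (φ := fun t => if t = 0 then euler r b f else (t : ℂ)⁻¹ • (dilation r b t f - f))
    (fun t ht => ?_) (continuousOn_differenceQuotient hyc hwc hyw) (fun t ht x => ?_)
  · have h1 := (hcont 0 h0).tendsto.mono_left
      (nhdsWithin_mono (0 : ℝ) (Set.Ioo_subset_Icc_self (a := 0) (b := 1)))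
    rw [nhdsWithin_Ioo_eq_nhdsGT zero_lt_one, if_pos rfl] at h1
    refine h1.congr' ?_
    filter_upwards [self_mem_nhdsWithin] with t ht
    exact if_neg (ne_of_gt ht)
  · split_ifs with h
    · simp only [hw0]
      exact ((hg.mono hVU0).const_mul b).add
        ((differentiableOn_id.const_mul _).mul (hdg.mono hVU0))
    · simp only [hy0]
      exact ((differentiableOn_dilate hg (hVU t ht)).sub (hg.mono hVU0)).const_mul _
  · split_ifs with h
    · have hderiv : deriv f x = deriv g x := by
        rw [show ⇑f = fun y : ℝ => g y from funext fun y => (hgf y).symm]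
        exact (hg.differentiableAt (U.isOpen.mem_nhds (hU x))).hasDerivAt.comp_ofReal.deriv
      rw [euler_apply, hderiv, hw0, hgf]
      ring
    · rw [hy0, hgf]
      change (t : ℂ)⁻¹ * (Complex.exp (b * t) * f (Real.exp (t * r) * x) - f x) = _
      rw [← hgf (Real.exp (t * r) * x), Complex.ofReal_mul]

/-- The weighted dilations form a `C₀`-semigroup generated by the Euler operator. -/
theorem generates_euler_dilation (r : ℝ) (b : ℂ) :
    Generates (euler r b) fun t : ℝ≥0 => ⟨dilation r b t, continuous_dilation r b t⟩ := by
  refine ⟨⟨fun t s => ?_, ?_, fun s f => ?_⟩, Set.ext fun p => ?_⟩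
  · refine ContinuousLinearMap.ext fun f => DFunLike.ext _ _ fun x => ?_
    change Complex.exp (b * ((t + s : ℝ≥0) : ℝ)) * f (Real.exp ((t + s : ℝ≥0) * r) * x) =
      Complex.exp (b * (t : ℝ)) * (Complex.exp (b * (s : ℝ)) *
        f (Real.exp (s * r) * (Real.exp (t * r) * x)))
    rw [NNReal.coe_add, Complex.ofReal_add, mul_add, Complex.exp_add, ← mul_assoc (Real.exp _),
      ← Real.exp_add, add_mul, add_comm (s * r : ℝ), mul_assoc]
  · refine ContinuousLinearMap.ext fun f => DFunLike.ext _ _ fun x => ?_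
    change Complex.exp (b * ((0 : ℝ≥0) : ℝ)) * f (Real.exp ((0 : ℝ≥0) * r) * x) = f x
    simp
  · exact ((continuous_dilation_param r b f).comp NNReal.continuous_coe).tendsto s
  · have hcoe : Tendsto (fun t : ℝ≥0 => (t : ℝ)) (𝓝[>] 0) (𝓝[>] 0) :=
      NNReal.continuous_coe.continuousWithinAt.tendsto_nhdsWithin fun t ht =>
        NNReal.coe_pos.2 ht
    have h := (tendsto_differenceQuotient_dilation r b p.1).comp hcoe
    exact ⟨fun hp => tendsto_nhds_unique hp h, fun hp => by
      have hp' : p.2 = euler r b p.1 := hp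
      change Tendsto _ _ (𝓝 p.2)
      rw [hp']
      exact h⟩

end RealAnalytic

theorem mainTheorem2 (a b : ℂ) :
    Continuous (RealAnalytic.euler a b) ∧
    ((∃ T : ℝ≥0 → RealAnalytic →L[ℂ] RealAnalytic, Generates (RealAnalytic.euler a b) T) ↔
      ∃ r : ℝ, a = (r : ℂ)) ∧
    (∀ r : ℝ, a = (r : ℂ) →
      ∀ T : ℝ≥0 → RealAnalytic →L[ℂ] RealAnalytic, Generates (RealAnalytic.euler a b) T →
        ∀ (t : ℝ≥0) (f : RealAnalytic) (x : ℝ),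
          T t f x = Complex.exp (b * ((t : ℝ) : ℂ)) * f (Real.exp ((t : ℝ) * r) * x)) := by
  refine ⟨RealAnalytic.continuous_euler a b, ⟨?_, ?_⟩, ?_⟩
  · rintro ⟨T, hT⟩
    exact ⟨a.re, Complex.ext rfl (RealAnalytic.im_eq_zero_of_generates_euler hT)⟩
  · rintro ⟨r, rfl⟩
    exact ⟨_, RealAnalytic.generates_euler_dilation r b⟩
  · rintro r rfl T hT t f x
    exact RealAnalytic.eq_of_generates_euler hT t f x
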